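/- A quasimodular form of weight $w$ for $\mathrm{SL}_2(\mathbb{Z})$ is a function on the upper half plane of the form $f=\sum_{0\le j\le w/2}E_2^{\,j}f_j$, where $f_j$ is a modular form of weight $w-2j$ for $\mathrm{SL}_2(\mathbb{Z})$ and $E_2=1-24\sum_{n\ge1}\sigma_1(n)q^n$, $q=e^{2\pi i z}$. Write $f=\sum_{n\ge 0}a_f(n)q^n$ and $\mathrm{ord}_\infty(f)=\min\{n: a_f(n)\neq 0\}$, with $\mathrm{ord}_\infty(0)=\infty$. **Theorem.** Let $k\ge 1$ be an integer, let $w\in\{k,2k\}$, and let $f$ be a quasimodular form of weight $w$ for $\mathrm{SL}_2(\mathbb{Z})$. Then $f$ is determined uniquely, among quasimodular forms of weight $w$, by its first $\left\lceil \frac{k^4\log k}{2}\right\rceil+1$ Fourier coefficients: if $g$ is a quasimodular form of weight $w$ with $a_f(n)=a_g(n)$ for all $0\le n\le\left\lceil \frac{k^4\log k}{2}\right\rceil$, then $f=g$. Equivalently, if $\mathrm{ord}_\infty(f)>\left\lceil \frac{k^4\log k}{2}\right\rceil$, then $f=0$. -/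

import Mathlib

/-- A quasimodular form of (pure) weight `w` for `SL₂(ℤ)`: a function on the upper half plane of
the shape `f = ∑ⱼ E₂ʲ fⱼ`, the sum running over `0 ≤ j` with `2j ≤ w`, where `fⱼ` is a (complex)
modular form for `SL₂(ℤ)` of weight `w - 2j`, and `E₂ = 1 - 24 ∑ σ₁(n) qⁿ` is the Eisenstein series
of weight two. -/
def IsQuasimodularForm (w : ℕ) (f : UpperHalfPlane → ℂ) : Prop :=
  ∃ g : (j : ℕ) → ModularForm (Matrix.SpecialLinearGroup.mapGL ℝ :
      Matrix.SpecialLinearGroup (Fin 2) ℤ →* GL (Fin 2) ℝ).range ((w : ℤ) - 2 * (j : ℤ)),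
    ∀ z : UpperHalfPlane,
      f z = ∑ j ∈ Finset.range (w / 2 + 1), EisensteinSeries.E2 z ^ j * g j z

/-- The `n`-th Fourier coefficient `a_f(n)` in `f(z) = ∑ a_f(n) qⁿ`, `q = exp (2πiz)`. -/
noncomputable def fourierCoefficient (f : UpperHalfPlane → ℂ) (n : ℕ) : ℂ :=
  (UpperHalfPlane.qExpansion 1 f).coeff n

/-- The order of vanishing at infinity: the least `n` with `a_f(n) ≠ 0`
(and `⊤` if there is no such `n`). -/
noncomputable def ordAtInfinity (f : UpperHalfPlane → ℂ) : ℕ∞ :=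
  (UpperHalfPlane.qExpansion 1 f).order

/-!
A nonzero quasimodular form `f = ∑ⱼ E₂ʲ fⱼ` of weight `w` and depth at most `p` satisfies
`ord_∞ f ≤ (p + 1) w / 12`; with `p = ⌊w / 2⌋` and `w ≤ 2k` this does not exceed the stated bound.

Write `δ = 12 q d/dq`. Modular forms `φ` of weight `k` satisfy `δ φ - k E₂ φ ∈ M_{k+2}`
(`levelOneQExpansions.serreDerivative_mem`), and `δ E₂ - E₂² ∈ M₄`
(`levelOneQExpansions.ramanujan_mem`). Consequently the operator `f ↦ δ f - (w - p) E₂ f` maps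
quasimodular forms of weight `w` and depth at most `p` to quasimodular forms of weight `w + 2` and
depth at most `p`. Applying it repeatedly gives `f = f⁽⁰⁾, f⁽¹⁾, …, f⁽ᵖ⁾`, and the coefficients of
these with respect to `1, E₂, …, E₂ᵖ` form a square matrix `A` of modular forms. Three facts about
`det A` carry the proof.

* The determinant is a modular form of weight `(p + 1) w`, because the weights in its expansion add
  up to the same total for every permutation (`det_iterateMatrix_mem`).
* It vanishes at `i∞` at least to the order of `f`: by Cramer's rule it is a combination of the
  `f⁽ʳ⁾`, and the Euler operator does not lower the order (`X_pow_dvd_det`).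
* It is nonzero when `f ≠ 0` (`det_iterateMatrix_ne_zero`). The relations between `δ`, `E₂` and
  `δ E₂ - E₂²` also hold formally after replacing the pair `(1, E₂)` by `(X, X E₂ + 12)`, where
  `δ X = 12`; analytically this is the transformation `z ↦ -1/z` with `X = 2πi z`. So the rows of
  `A` are also the coefficients of twisted iterated derivatives of a polynomial `Φ ∈ ℂ((q))[X]`,
  whose coefficient at `Xᵖ` is `f`. A derivative in `ℂ((q))` has no constant term, so differentiating
  a monic polynomial in `X` lowers its degree by exactly one; hence a `δ`-stable subspace that
  contains `Φ` has dimension at least `p + 1`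
  (`degreeLT_le_of_extendPolynomial_mem`), and the rows of `A` are linearly independent.

The Sturm bound for modular forms of level one then finishes the argument
(`IsQuasimodularForm.eq_zero_of_X_pow_dvd`). Apart from the modularity of the two Serre derivatives,
everything takes place in the ring of `q`-expansions.
-/

/-! ### The Euler operator on formal power series and Laurent series -/

/-- An additive map that satisfies the Leibniz rule is a `ℤ`-linear derivation. -/
def Derivation.ofAddMonoidHom {F : Type*} [CommRing F] (f : F →+ F)
    (hf : ∀ x y, f (x * y) = x * f y + y * f x) : Derivation ℤ F F :=
  .mk' f.toIntLinearMap hf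

namespace LaurentSeries

lemma isPWO_support_intCast_mul (x : LaurentSeries ℂ) :
    (Function.support fun n : ℤ ↦ (n : ℂ) * x.coeff n).IsPWO :=
  x.isPWO_support.mono fun _ hn ↦ right_ne_zero_of_mul hn

/-- The additive map underlying the Euler operator on formal Laurent series. -/
noncomputable def eulerAddHom : LaurentSeries ℂ →+ LaurentSeries ℂ where
  toFun x := ⟨fun n : ℤ ↦ (n : ℂ) * x.coeff n, x.isPWO_support_intCast_mul⟩
  map_zero' := by ext n; simp
  map_add' x y := by ext n; simp [mul_add]

lemma coeff_eulerAddHom (x : LaurentSeries ℂ) (n : ℤ) :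
    (eulerAddHom x).coeff n = n * x.coeff n := rfl

lemma eulerAddHom_mul (x y : LaurentSeries ℂ) :
    eulerAddHom (x * y) = x * eulerAddHom y + y * eulerAddHom x := by
  have hsupp (z : LaurentSeries ℂ) : (eulerAddHom z).support ⊆ z.support :=
    fun n hn ↦ right_ne_zero_of_mul hn
  ext n
  rw [HahnSeries.coeff_add, coeff_eulerAddHom,
    HahnSeries.coeff_mul_right' y.isPWO_support (hsupp y), mul_comm y,
    HahnSeries.coeff_mul_left' x.isPWO_support (hsupp x), HahnSeries.coeff_mul, Finset.mul_sum,
    ← Finset.sum_add_distrib]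
  refine Finset.sum_congr rfl fun ij hij ↦ ?_
  obtain ⟨-, -, rfl⟩ := Finset.mem_antidiagonal.mp hij
  rw [coeff_eulerAddHom, coeff_eulerAddHom]
  push_cast
  ring

/-- The Euler operator `θ = q d/dq` on formal Laurent series, as a `ℤ`-linear derivation. -/
-- The type is left to `Derivation.ofAddMonoidHom`: written out, it would pick up the algebra structure
-- on Laurent series that factors through power series.
noncomputable def euler := Derivation.ofAddMonoidHom eulerAddHom eulerAddHom_mul

@[simp]
lemma coeff_euler (x : LaurentSeries ℂ) (n : ℤ) : (euler x).coeff n = n * x.coeff n := rfl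

end LaurentSeries

namespace PowerSeries

/-- The Euler operator `θ = q d/dq` on formal power series. -/
noncomputable def euler : Derivation ℂ (PowerSeries ℂ) (PowerSeries ℂ) :=
  (X : PowerSeries ℂ) • derivative ℂ

@[simp]
lemma coeff_euler (x : PowerSeries ℂ) (n : ℕ) : coeff n (euler x) = n * coeff n x := by
  cases n with
  | zero => simp [euler]
  | succ n => simp [euler, coeff_succ_X_mul, coeff_derivative, mul_comm]

lemma X_pow_dvd_euler {n : ℕ} {x : PowerSeries ℂ} (h : X ^ n ∣ x) : X ^ n ∣ euler x := by
  rw [X_pow_dvd_iff] at h ⊢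
  intro m hm
  simp [h m hm]

lemma ofPowerSeries_euler (x : PowerSeries ℂ) :
    HahnSeries.ofPowerSeries ℤ ℂ (euler x) =
      LaurentSeries.euler (HahnSeries.ofPowerSeries ℤ ℂ x) := by
  ext n
  rw [LaurentSeries.coeff_euler]
  rcases lt_or_ge n 0 with hn | hn
  · have (y : PowerSeries ℂ) : (HahnSeries.ofPowerSeries ℤ ℂ y).coeff n = 0 := by
      rw [HahnSeries.ofPowerSeries_apply]
      apply HahnSeries.embDomain_of_notMem_range
      rintro ⟨m, hm⟩
      simp at hm
      omega
    simp [this]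
  · lift n to ℕ using hn
    have (y : PowerSeries ℂ) : (HahnSeries.ofPowerSeries ℤ ℂ y).coeff (n : ℤ) = coeff n y :=
      HahnSeries.ofPowerSeries_apply_coeff y n
    simp [this]

end PowerSeries

/-! ### Derivations of a polynomial ring and cyclic vectors -/

section PolynomialDerivation

open Polynomial

variable {F : Type*} [Field F]

/-- The derivation of `F[X]` that extends the derivation `d` of `F` and maps `X` to `c`. -/
noncomputable def Derivation.extendPolynomial (d : Derivation ℤ F F) (c : F) :
    Derivation ℤ F[X] F[X] :=
  PolynomialModule.equivPolynomialSelf.compDer d.mapCoeffs +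
    (C c • derivative' (R := F)).restrictScalars ℤ

@[simp]
lemma Derivation.coeff_extendPolynomial (d : Derivation ℤ F F) (c : F) (f : F[X]) (n : ℕ) :
    (d.extendPolynomial c f).coeff n = d (f.coeff n) + c * (f.coeff (n + 1) * (n + 1)) := by
  simp [extendPolynomial, coeff_derivative]
  rfl

lemma Derivation.extendPolynomial_C (d : Derivation ℤ F F) (c a : F) :
    d.extendPolynomial c (C a) = C (d a) := by
  ext n
  cases n <;> simp [coeff_C]

lemma Derivation.extendPolynomial_X (d : Derivation ℤ F F) (c : F) :
    d.extendPolynomial c X = C c := by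
  ext n
  rcases n with _ | n
  · simp
  · simp [coeff_X, apply_ite d]

lemma Derivation.extendPolynomial_smul (d : Derivation ℤ F F) (c a : F) (f : F[X]) :
    d.extendPolynomial c (a • f) = a • d.extendPolynomial c f + d a • f := by
  rw [smul_eq_C_mul, Derivation.leibniz, Derivation.extendPolynomial_C, smul_eq_mul, smul_eq_mul,
    smul_eq_C_mul, smul_eq_C_mul, mul_comm f]

/-- If no multiple `n c` with `n ≠ 0` is a derivative in `F`, then a subspace of `F[X]` that is
stable under the derivation and contains a polynomial of degree `p` contains all polynomials of
degree at most `p`: differentiating a monic polynomial lowers its degree by exactly one. -/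
lemma degreeLT_le_of_extendPolynomial_mem {d : Derivation ℤ F F} {c : F}
    (hc : ∀ (u : F) (n : ℕ), n ≠ 0 → d u + n * c ≠ 0) {U : Submodule F F[X]}
    (hU : ∀ f ∈ U, d.extendPolynomial c f ∈ U) {p : ℕ} {f : F[X]} (hf : f ∈ U) (hf0 : f ≠ 0)
    (hp : f.natDegree = p) : degreeLT F (p + 1) ≤ U := by
  induction p generalizing f with
  | zero =>
    intro h hh
    rw [zero_add, mem_degreeLT] at hh
    rw [eq_C_of_natDegree_eq_zero hp] at hf hf0
    have hne : f.coeff 0 ≠ 0 := fun h ↦ hf0 (by rw [h, C_0])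
    obtain ⟨a, rfl⟩ : ∃ a, h = C a :=
      ⟨h.coeff 0, eq_C_of_degree_le_zero (Nat.WithBot.lt_one_iff_le_zero.mp (by simpa using hh))⟩
    convert U.smul_mem (a * (f.coeff 0)⁻¹) hf using 1
    rw [smul_C, smul_eq_mul, inv_mul_cancel_right₀ hne]
  | succ p ih =>
    set f₁ := f.leadingCoeff⁻¹ • f with hf₁
    have hf₁U : f₁ ∈ U := U.smul_mem _ hf
    have hlead : f₁.coeff (p + 1) = 1 := by
      rw [hf₁, coeff_smul, ← hp, coeff_natDegree, smul_eq_mul,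
        inv_mul_cancel₀ (leadingCoeff_ne_zero.mpr hf0)]
    have hbig (n : ℕ) (hn : p + 1 < n) : f₁.coeff n = 0 := by
      rw [hf₁, coeff_smul, coeff_eq_zero_of_natDegree_lt (hp ▸ hn), smul_zero]
    have hcoeff : (d.extendPolynomial c f₁).coeff p ≠ 0 := by
      rw [Derivation.coeff_extendPolynomial, hlead]
      convert hc (f₁.coeff p) (p + 1) p.succ_ne_zero using 2
      push_cast
      ring
    have hdeg : (d.extendPolynomial c f₁).natDegree = p := by
      refine natDegree_eq_of_le_of_coeff_ne_zero (natDegree_le_iff_coeff_eq_zero.mpr ?_) hcoeff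
      intro n hn
      rw [Derivation.coeff_extendPolynomial, hbig (n + 1) (by omega)]
      rcases (Nat.succ_le_of_lt hn).eq_or_lt with rfl | hn
      · simp [hlead]
      · simp [hbig n hn]
    have hle := ih (hU _ hf₁U) (fun h ↦ hcoeff (by rw [h, coeff_zero])) hdeg
    intro h hh
    rw [← sub_add_cancel h (h.coeff (p + 1) • f₁)]
    refine U.add_mem (hle ?_) (U.smul_mem _ hf₁U)
    rw [mem_degreeLT, degree_lt_iff_coeff_zero] at hh ⊢
    intro n hn
    rcases hn.eq_or_lt with rfl | hn
    · simp [hlead]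
    · simp [hbig n hn, hh n hn]

/-- A polynomial of degree `p` in `F[X]` and its first `p` (twisted) derivatives are linearly
independent over `F`. -/
lemma linearIndependent_of_extendPolynomial {d : Derivation ℤ F F} {c : F}
    (hc : ∀ (u : F) (n : ℕ), n ≠ 0 → d u + n * c ≠ 0) {Φ : ℕ → F[X]} {b : ℕ → F}
    (hΦ : ∀ r, d.extendPolynomial c (Φ r) = Φ (r + 1) + b r • Φ r) (h0 : Φ 0 ≠ 0) {m : ℕ}
    (hm : m ≤ (Φ 0).natDegree + 1) : LinearIndependent F fun i : Fin m ↦ Φ i := by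
  induction m with
  | zero => exact linearIndependent_empty_type
  | succ m ih =>
    have hsnoc : (fun i : Fin (m + 1) ↦ Φ i) = Fin.snoc (fun i : Fin m ↦ Φ i) (Φ m) := by
      ext1 i
      refine Fin.lastCases ?_ (fun i ↦ ?_) i <;> simp
    rw [hsnoc, linearIndependent_finSnoc]
    refine ⟨ih (by omega), fun hmem ↦ ?_⟩
    set U := Submodule.span F (Set.range fun i : Fin m ↦ Φ i) with hUdef
    have hmemU (i : ℕ) (hi : i ≤ m) : Φ i ∈ U := by
      rcases hi.eq_or_lt with rfl | hi
      · exact hmem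
      · exact Submodule.subset_span ⟨⟨i, hi⟩, rfl⟩
    have hU (f : F[X]) (hf : f ∈ U) : d.extendPolynomial c f ∈ U := by
      induction hf using Submodule.span_induction with
      | mem f hf =>
        obtain ⟨i, rfl⟩ := hf
        rw [hΦ]
        exact U.add_mem (hmemU _ i.2) (U.smul_mem _ (hmemU _ i.2.le))
      | zero => simp
      | add f g _ _ hf hg => rw [map_add]; exact U.add_mem hf hg
      | smul a f hf hDf =>
        rw [Derivation.extendPolynomial_smul]
        exact U.add_mem (U.smul_mem _ hDf) (U.smul_mem _ hf)
    have hle := degreeLT_le_of_extendPolynomial_mem hc hU (hmemU 0 m.zero_le) h0 rfl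
    have : FiniteDimensional F U := FiniteDimensional.span_of_finite F (Set.finite_range _)
    have h1 := Submodule.finrank_mono hle
    have h2 : Module.finrank F U ≤ m := by
      simpa using! finrank_range_le_card (R := F) fun i : Fin m ↦ Φ i
    rw [(degreeLTEquiv F _).finrank_eq, Module.finrank_fin_fun] at h1
    omega

end PolynomialDerivation

/-! ### Iterated Serre derivatives of a quasimodular form -/

section IteratedSerre

variable {k k' R S : Type*} [CommRing k] [CommRing R] [Algebra k R] [CommRing k'] [CommRing S]
  [Algebra k' S]

/-- The index shift `(a₀, a₁, a₂, …) ↦ (0, a₀, a₁, …)`. -/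
def shiftIndex (a : ℕ → R) : ℕ → R
  | 0 => 0
  | j + 1 => a j

/-- The coefficients of the iterated Serre derivatives. If `δ e = e² + g`, and `f = ∑ⱼ eʲ v j` is a
quasimodular form of weight `w` and depth at most `p`, then the operator
`f ↦ δ f - (w - p) e f` preserves the depth bound and raises the weight by two; the `r`-th iterate
is `∑ⱼ eʲ (serreIterate δ e g w p v r j)`. -/
def serreIterate (δ : Derivation k R R) (e g : R) (w p : ℤ) (v : ℕ → R) : ℕ → ℕ → R
  | 0 => v
  | r + 1 => fun j ↦
      δ (serreIterate δ e g w p v r j) -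
        ((w + 2 * r - 2 * j : ℤ) : R) * e * serreIterate δ e g w p v r j +
        ((p + 1 - j : ℤ) : R) * shiftIndex (serreIterate δ e g w p v r) j +
        ((j + 1 : ℤ) : R) * g * serreIterate δ e g w p v r (j + 1)

lemma serreIterate_eq_zero (δ : Derivation k R R) (e g : R) (w : ℤ) (p : ℕ) {v : ℕ → R}
    (hv : ∀ j, p < j → v j = 0) (r j : ℕ) (hj : p < j) : serreIterate δ e g w p v r j = 0 := by
  induction r generalizing j with
  | zero => exact hv j hj
  | succ r ih =>
    obtain ⟨j, rfl⟩ : ∃ i, j = i + 1 := ⟨j - 1, by omega⟩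
    rcases (Nat.lt_succ_iff.mp hj).eq_or_lt with rfl | hj
    · simp [serreIterate, ih (p + 1) hj, ih (p + 1 + 1) (by omega)]
    · simp [serreIterate, shiftIndex, ih j hj, ih (j + 1) (by omega), ih (j + 1 + 1) (by omega)]

/-- The homogeneous polynomial `∑ⱼ xᵖ⁻ʲ yʲ a j` of degree `p` in `x` and `y`. -/
def binaryForm (p : ℕ) (x y : S) (a : ℕ → S) : S :=
  ∑ j ∈ Finset.range (p + 1), x ^ (p - j) * y ^ j * a j

/-- Whenever the derivation of `S` satisfies `∂ x = y - x e` and `∂ y = e y + x g`, the binary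
forms with coefficients `serreIterate` are iterated derivatives of each other, up to multiples of
`e`. The choice `(x, y) = (1, e)` gives a quasimodular form itself, and the choice
`(x, y) = (X, X e + 12)` its transform under `z ↦ -1/z`, where `X` stands for `2πi z`. -/
lemma derivation_binaryForm (δ : Derivation k R R) (D : Derivation k' S S) (φ : R →+* S)
    (hφ : ∀ a, φ (δ a) = D (φ a)) (e g : R) (w : ℤ) (p : ℕ) {v : ℕ → R}
    (hv : ∀ j, p < j → v j = 0) {x y : S} (hx : D x = y - x * φ e)
    (hy : D y = φ e * y + x * φ g) (r : ℕ) :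
    D (binaryForm p x y fun j ↦ φ (serreIterate δ e g w p v r j)) =
      binaryForm p x y (fun j ↦ φ (serreIterate δ e g w p v (r + 1) j)) +
        ((w + 2 * r - p : ℤ) : S) * φ e *
          binaryForm p x y fun j ↦ φ (serreIterate δ e g w p v r j) := by
  set a := serreIterate δ e g w p v r with ha
  have hap : a (p + 1) = 0 := serreIterate_eq_zero δ e g w p hv r _ p.lt_succ_self
  have hD (j : ℕ) (hj : j ∈ Finset.range (p + 1)) : D (x ^ (p - j) * y ^ j * φ (a j)) =
      ((p : S) - j) * (x ^ (p - (j + 1)) * y ^ (j + 1) * φ (a j)) +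
      (2 * j - p) * φ e * (x ^ (p - j) * y ^ j * φ (a j)) +
      j * φ g * (x ^ (p - j + 1) * y ^ (j - 1) * φ (a j)) +
      x ^ (p - j) * y ^ j * φ (δ (a j)) := by
    obtain ⟨i, rfl⟩ := Nat.exists_eq_add_of_le (Nat.lt_succ_iff.mp (Finset.mem_range.mp hj))
    rw [hφ, Nat.add_sub_cancel_left, show j + i - (j + 1) = i - 1 by omega]
    simp only [Derivation.leibniz, Derivation.leibniz_pow, hx, hy, smul_eq_mul, nsmul_eq_mul]
    rcases i with _ | i <;> rcases j with _ | j <;> push_cast <;>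
      (try simp only [zero_add, add_zero]) <;> ring
  have hup : ∑ j ∈ Finset.range (p + 1),
      ((p : S) - j) * (x ^ (p - (j + 1)) * y ^ (j + 1) * φ (a j)) =
      ∑ j ∈ Finset.range (p + 1),
        ((p : S) + 1 - j) * (x ^ (p - j) * y ^ j * φ (shiftIndex a j)) := by
    rw [Finset.sum_range_succ, Finset.sum_range_succ']
    simp [shiftIndex]
  have hdown : ∑ j ∈ Finset.range (p + 1), j * φ g * (x ^ (p - j + 1) * y ^ (j - 1) * φ (a j)) =
      ∑ j ∈ Finset.range (p + 1), ((j : S) + 1) * φ g * (x ^ (p - j) * y ^ j * φ (a (j + 1))) := by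
    rw [Finset.sum_range_succ', Finset.sum_range_succ _ p, hap]
    simp only [Nat.cast_zero, zero_mul, map_zero, mul_zero, add_zero]
    refine Finset.sum_congr rfl fun j hj ↦ ?_
    rw [show p - (j + 1) + 1 = p - j by have := Finset.mem_range.mp hj; omega]
    push_cast
    simp
  rw [binaryForm, map_sum, Finset.sum_congr rfl hD]
  simp only [Finset.sum_add_distrib]
  simp only [binaryForm]
  rw [hup, hdown, Finset.mul_sum, ← Finset.sum_add_distrib,
    ← Finset.sum_add_distrib, ← Finset.sum_add_distrib, ← Finset.sum_add_distrib]
  refine Finset.sum_congr rfl fun j _ ↦ ?_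
  simp only [serreIterate, ← ha, map_add, map_sub, map_mul, map_intCast]
  push_cast
  ring

end IteratedSerre

/-! ### Periodic holomorphic functions on the upper half plane and their `q`-expansions -/

open UpperHalfPlane hiding I
open Complex ModularForm Function Derivative EisensteinSeries
open scoped Real MatrixGroups Manifold Topology

/-- The algebra of holomorphic functions on the upper half plane that are invariant under
`z ↦ z + 1` and bounded at `i∞`. These are the functions with a convergent `q`-expansion. -/
noncomputable def cuspRegularFunctions : Subalgebra ℂ (ℍ → ℂ) where
  carrier := {f | Periodic (f ∘ ofComplex) 1 ∧ MDiff f ∧ IsBoundedAtImInfty f}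
  mul_mem' hf hg := ⟨hf.1.mul hg.1, hf.2.1.mul hg.2.1, hf.2.2.mul hg.2.2⟩
  add_mem' hf hg := ⟨hf.1.add hg.1, hf.2.1.add hg.2.1, hf.2.2.add hg.2.2⟩
  algebraMap_mem' c := ⟨fun _ ↦ rfl, mdifferentiable_const,
    Filter.const_boundedAtFilter atImInfty c⟩

namespace cuspRegularFunctions

lemma analyticAt {f : ℍ → ℂ} (hf : f ∈ cuspRegularFunctions) :
    AnalyticAt ℂ (cuspFunction 1 f) 0 :=
  analyticAt_cuspFunction_zero one_pos (by simpa using hf.1) hf.2.1 hf.2.2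

lemma qExpansion_eq_zero_iff {f : ℍ → ℂ} (hf : f ∈ cuspRegularFunctions) :
    qExpansion 1 f = 0 ↔ f = 0 :=
  UpperHalfPlane.qExpansion_eq_zero_iff one_pos (by simpa using hf.1) hf.2.1 hf.2.2

/-- The `q`-expansion as a ring homomorphism. -/
noncomputable def qExpansionHom : cuspRegularFunctions →+* PowerSeries ℂ where
  toFun f := qExpansion 1 f
  map_one' := qExpansion_one 1
  map_zero' := qExpansion_zero 1
  map_mul' f g := qExpansion_mul (analyticAt f.2) (analyticAt g.2)
  map_add' f g := qExpansion_add (analyticAt f.2) (analyticAt g.2)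

lemma qExpansionHom_apply (f : cuspRegularFunctions) : qExpansionHom f = qExpansion 1 f := rfl

/-- A holomorphic function given by a power series in `q` is regular at the cusp. -/
lemma mem_of_hasSum {f : ℍ → ℂ} (hf : MDiff f) {c : ℕ → ℂ}
    (h : ∀ z : ℍ, HasSum (fun m ↦ c m • Periodic.qParam 1 z ^ m) (f z)) :
    f ∈ cuspRegularFunctions := by
  refine ⟨fun w ↦ ?_, hf, isBoundedAtImInfty_of_hasSum_qExpansion one_pos h⟩
  by_cases hw : 0 < im w
  · have hw' : 0 < im (w + 1) := by simpa using hw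
    simp only [comp_apply, ofComplex_apply_of_im_pos hw', ofComplex_apply_of_im_pos hw]
    refine (h _).unique ?_
    convert h ⟨w, hw⟩ using 4
    simp [Periodic.qParam, mul_add, exp_add]
  · have hw' : im (w + 1) ≤ 0 := by simpa using hw
    simp [ofComplex_apply_of_im_nonpos hw', ofComplex_apply_of_im_nonpos (not_lt.mp hw)]

lemma coe_mem {k : ℤ} (f : ModularForm 𝒮ℒ k) : ⇑f ∈ cuspRegularFunctions :=
  ⟨by simpa using SlashInvariantFormClass.periodic_comp_ofComplex f one_mem_strictPeriods_SL,
    f.holo', ModularFormClass.bdd_at_infty f⟩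

lemma E2_mem : E2 ∈ cuspRegularFunctions :=
  mem_of_hasSum E2_mdifferentiable fun z ↦ by
    simpa only [Periodic.qParam, ofReal_one, div_one] using hasSum_qExpansion_E2 (z := z)

lemma hasSum_normalizedDeriv {f : ℍ → ℂ} (hf : f ∈ cuspRegularFunctions) (z : ℍ) :
    HasSum (fun m ↦ (PowerSeries.euler (qExpansion 1 f)).coeff m • Periodic.qParam 1 z ^ m)
      (normalizedDerivOfComplex f z) := by
  have hper : Periodic (f ∘ ofComplex) (1 : ℝ) := by simpa using hf.1
  have hdiff := differentiableOn_cuspFunction_ball one_pos hper hf.2.1 hf.2.2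
  set q := Periodic.qParam 1 z with hq
  have hq1 : ‖q‖ < 1 := by simpa using Periodic.norm_qParam_lt_one one_pos z.im_pos
  have hmem : q ∈ Metric.ball (0 : ℂ) 1 := by simpa using hq1
  -- `D f = q F'(q)`, where `f = F(q)`.
  have hD : normalizedDerivOfComplex f z = q * deriv (cuspFunction 1 f) q := by
    have hqd : HasDerivAt (Periodic.qParam 1) (2 * π * I * q) (z : ℂ) := by
      have h := (((hasDerivAt_id (z : ℂ)).const_mul (2 * π * I)).div_const ((1 : ℝ) : ℂ)).cexp
      exact h.congr_deriv (by simp [hq, Periodic.qParam, mul_comm])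
    have hF : HasDerivAt (cuspFunction 1 f) (deriv (cuspFunction 1 f) q) q :=
      (hdiff.differentiableAt (Metric.isOpen_ball.mem_nhds hmem)).hasDerivAt
    have hcomp : f ∘ ofComplex =ᶠ[𝓝 (z : ℂ)] cuspFunction 1 f ∘ Periodic.qParam 1 := by
      filter_upwards [isOpen_upperHalfPlaneSet.mem_nhds z.im_pos] with w hw
      simpa [ofComplex_apply_of_im_pos hw] using
        (eq_cuspFunction (⟨w, hw⟩ : ℍ) one_ne_zero hper).symm
    rw [normalizedDerivOfComplex, hcomp.deriv_eq, (hF.comp (z : ℂ) hqd).deriv]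
    have := two_pi_I_ne_zero
    field_simp
  have h := hasSum_taylorSeries_on_ball (hdiff.deriv Metric.isOpen_ball) hmem
  have h0 : ∑ m ∈ Finset.range 1, (PowerSeries.euler (qExpansion 1 f)).coeff m • q ^ m = 0 := by
    simp [-PowerSeries.coeff_zero_eq_constantCoeff]
  rw [hD, ← hasSum_nat_add_iff' 1, h0, sub_zero]
  refine (h.mul_left q).congr_fun fun m ↦ ?_
  rw [PowerSeries.coeff_euler, qExpansion_coeff, ← iteratedDeriv_succ', Nat.factorial_succ]
  have : (m.factorial : ℂ) ≠ 0 := Nat.cast_ne_zero.mpr m.factorial_ne_zero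
  have : (m + 1 : ℂ) ≠ 0 := by exact_mod_cast m.succ_ne_zero
  push_cast
  simp only [smul_eq_mul, sub_zero]
  field_simp
  ring

lemma normalizedDeriv_mem {f : ℍ → ℂ} (hf : f ∈ cuspRegularFunctions) :
    normalizedDerivOfComplex f ∈ cuspRegularFunctions :=
  mem_of_hasSum (normalizedDerivOfComplex_mdifferentiable hf.2.1) (hasSum_normalizedDeriv hf)

lemma qExpansion_normalizedDeriv {f : ℍ → ℂ} (hf : f ∈ cuspRegularFunctions) :
    qExpansion 1 (normalizedDerivOfComplex f) = PowerSeries.euler (qExpansion 1 f) := by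
  have hD := analyticAt (normalizedDeriv_mem hf)
  have h1 := (hasFPowerSeriesOnBall_cuspFunction one_pos hD
    (hasSum_normalizedDeriv hf)).hasFPowerSeriesAt
  ext m
  have h2 := congr_arg (FormalMultilinearSeries.coeff · m)
    (hD.hasFPowerSeriesAt.eq_formalMultilinearSeries h1)
  rw [qExpansion_coeff, ← div_eq_inv_mul]
  simpa using h2

end cuspRegularFunctions

/-! ### The `q`-expansions of modular forms of level one -/

/-- The space of `q`-expansions of modular forms of weight `k` for `SL₂(ℤ)`. -/
noncomputable def levelOneQExpansions (k : ℤ) : Submodule ℂ (PowerSeries ℂ) where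
  carrier := {φ | ∃ f : ModularForm 𝒮ℒ k, qExpansion 1 f = φ}
  add_mem' := by
    rintro _ _ ⟨f, rfl⟩ ⟨g, rfl⟩
    exact ⟨f + g, ModularForm.qExpansion_add one_pos one_mem_strictPeriods_SL f g⟩
  zero_mem' := ⟨0, qExpansion_zero 1⟩
  smul_mem' := by
    rintro c _ ⟨f, rfl⟩
    exact ⟨c • f, ModularForm.qExpansion_smul one_pos one_mem_strictPeriods_SL c f⟩

namespace levelOneQExpansions

instance : SetLike.GradedMonoid levelOneQExpansions where
  one_mem := ⟨1, ModularForm.qExpansion_one⟩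
  mul_mem := by
    rintro _ _ _ _ ⟨f, rfl⟩ ⟨g, rfl⟩
    exact ⟨f.mul g, ModularForm.qExpansion_mul one_pos one_mem_strictPeriods_SL f g⟩

lemma eq_zero_of_X_pow_dvd {k : ℤ} {φ : PowerSeries ℂ} (hφ : φ ∈ levelOneQExpansions k) {n : ℕ}
    (hn : k.toNat / 12 < n) (h : PowerSeries.X ^ n ∣ φ) : φ = 0 := by
  obtain ⟨f, rfl⟩ := hφ
  have hf : f = 0 := ModularForm.sturm_bound_levelOne <| (Nat.cast_lt.mpr hn).trans_le <|
    PowerSeries.nat_le_order _ _ (PowerSeries.X_pow_dvd_iff.mp h)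
  rw [hf]
  exact qExpansion_zero 1

/-- A function in `cuspRegularFunctions` that is invariant under the slash action of weight `k` is a
modular form, since `SL₂(ℤ)` permutes the cusps transitively. -/
lemma qExpansion_mem {k : ℤ} {f : ℍ → ℂ} (hf : f ∈ cuspRegularFunctions)
    (hslash : ∀ γ : SL(2, ℤ), f ∣[k] γ = f) : qExpansion 1 f ∈ levelOneQExpansions k :=
  ⟨{  toFun := f
      slash_action_eq' := by
        rintro _ ⟨γ, rfl⟩
        exact hslash γ
      holo' := hf.2.1
      bdd_at_cusps' := fun hc ↦ by
        rw [OnePoint.isBoundedAt_iff_forall_SL2Z hc]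
        intro γ _
        rw [hslash]
        exact hf.2.2 }, rfl⟩

/-- The operator `12 q d/dq - k E₂` maps modular forms of weight `k` to modular forms of
weight `k + 2`. -/
lemma serreDerivative_mem {k : ℤ} {φ : PowerSeries ℂ} (hφ : φ ∈ levelOneQExpansions k) :
    12 * PowerSeries.euler φ - (k : PowerSeries ℂ) * qExpansion 1 E2 * φ ∈
      levelOneQExpansions (k + 2) := by
  obtain ⟨f, rfl⟩ := hφ
  have hD := cuspRegularFunctions.normalizedDeriv_mem (cuspRegularFunctions.coe_mem f)
  have hE := mul_mem cuspRegularFunctions.E2_mem (cuspRegularFunctions.coe_mem f)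
  have hserre : serreDerivative k f = normalizedDerivOfComplex f - (k * 12⁻¹ : ℂ) • (E2 * f) := by
    ext z
    simp [mul_assoc]
  have hmem : serreDerivative k f ∈ cuspRegularFunctions :=
    hserre ▸ sub_mem hD (Subalgebra.smul_mem _ hE _)
  convert (levelOneQExpansions (k + 2)).smul_mem (12 : ℂ) (qExpansion_mem hmem fun γ ↦
    serreDerivative_slash_invariant f.holo' (f.slash_action_eq' _ ⟨γ, rfl⟩)) using 1
  rw [hserre, qExpansion_sub (cuspRegularFunctions.analyticAt hD)
      (cuspRegularFunctions.analyticAt (Subalgebra.smul_mem _ hE _)),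
    qExpansion_smul (cuspRegularFunctions.analyticAt hE),
    qExpansion_mul (cuspRegularFunctions.analyticAt cuspRegularFunctions.E2_mem)
      (cuspRegularFunctions.analyticAt (cuspRegularFunctions.coe_mem f)),
    cuspRegularFunctions.qExpansion_normalizedDeriv (cuspRegularFunctions.coe_mem f),
    smul_sub, smul_smul, show (12 * (k * 12⁻¹) : ℂ) = k by ring, Int.cast_smul_eq_zsmul,
    zsmul_eq_mul, mul_assoc]
  congr 1
  rw [show (12 : ℂ) = (12 : ℕ) by norm_num, Nat.cast_smul_eq_nsmul, nsmul_eq_mul]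
  norm_num

/-- The failure of `E₂` to be modular is compensated by its derivative. -/
lemma E2_ramanujan_slash (γ : SL(2, ℤ)) :
    ((12 : ℂ) • normalizedDerivOfComplex E2 - E2 ^ 2) ∣[(4 : ℤ)] γ =
      (12 : ℂ) • normalizedDerivOfComplex E2 - E2 ^ 2 := by
  -- `E₂ ∣ γ = E₂ + α` with `12 D α = -α²`
  set α : ℍ → ℂ := fun z ↦ 12 * (2 * π * I)⁻¹ * (γ 1 0 / denom γ z) with hα
  have hE : E2 ∣[(2 : ℤ)] γ = E2 + α := by
    rw [E2_slash_action]
    ext z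
    simp only [Pi.sub_apply, Pi.smul_apply, Pi.add_apply, D2, riemannZeta_two, hα, smul_eq_mul]
    have := denom_ne_zero γ z
    have hπ : (π : ℂ) ≠ 0 := mod_cast Real.pi_ne_zero
    field_simp
    ring_nf
    simp only [I_sq]
    ring
  have hαderiv (z : ℍ) : HasDerivAt (α ∘ ofComplex)
      (12 * (2 * π * I)⁻¹ * (γ 1 0 * (-γ 1 0 * denom γ z ^ (-2 : ℤ)))) z := by
    have h := ((hasDerivAt_denom_zpow γ (-1) z).const_mul (γ 1 0 : ℂ)).const_mul
      (12 * (2 * π * I)⁻¹)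
    refine (h.congr_of_eventuallyEq ?_).congr_deriv (by simp)
    filter_upwards [isOpen_upperHalfPlaneSet.mem_nhds z.im_pos] with w hw
    simp [hα, ofComplex_apply_of_im_pos hw, div_eq_mul_inv]
  have hαD (z : ℍ) : 12 * normalizedDerivOfComplex α z = -α z ^ 2 := by
    rw [normalizedDerivOfComplex, (hαderiv z).deriv]
    have := denom_ne_zero γ z
    have := two_pi_I_ne_zero
    simp only [hα]
    field_simp
  have hαdiff : MDiff α := fun z ↦
    mdifferentiableAt_iff.mpr (hαderiv z).differentiableAt
  have hD := normalizedDerivOfComplex_SL_slash (k := 2) E2_mdifferentiable (γ := γ)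
  rw [hE, normalizedDerivOfComplex_add _ _ E2_mdifferentiable hαdiff] at hD
  have hsq := ModularForm.mul_slash_SL2 2 2 γ E2 E2
  rw [hE, ← pow_two] at hsq
  ext z
  have hDz := congrFun hD z
  have hsqz := congrFun hsq z
  simp only [Pi.add_apply, Pi.sub_apply, Pi.mul_apply] at hDz hsqz
  rw [show (2 + 2 : ℤ) = 4 from rfl] at hDz hsqz
  push_cast at hDz
  rw [sub_eq_add_neg, SlashAction.add_slash, SlashAction.neg_slash, ModularForm.SL_smul_slash]
  simp only [Pi.add_apply, Pi.neg_apply, Pi.smul_apply, Pi.pow_apply, smul_eq_mul]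
  rw [hsqz]
  have hαz : α z = 12 * (2 * π * I)⁻¹ * (γ 1 0 / denom γ z) := rfl
  linear_combination (-12) * hDz + hαD z - 2 * (E2 z + α z) * hαz

/-- A form of Ramanujan's identity `12 q dE₂/dq = E₂² - E₄`: the difference is modular of weight
four. -/
lemma ramanujan_mem :
    12 * PowerSeries.euler (qExpansion 1 E2) - qExpansion 1 E2 ^ 2 ∈ levelOneQExpansions 4 := by
  have hE := cuspRegularFunctions.E2_mem
  have hD := cuspRegularFunctions.normalizedDeriv_mem hE
  have h12 := Subalgebra.smul_mem cuspRegularFunctions hD 12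
  convert qExpansion_mem (sub_mem h12 (pow_mem hE 2)) E2_ramanujan_slash using 1
  rw [qExpansion_sub (cuspRegularFunctions.analyticAt h12)
      (cuspRegularFunctions.analyticAt (pow_mem hE 2)),
    qExpansion_smul (cuspRegularFunctions.analyticAt hD), pow_two, pow_two,
    qExpansion_mul (cuspRegularFunctions.analyticAt hE) (cuspRegularFunctions.analyticAt hE),
    cuspRegularFunctions.qExpansion_normalizedDeriv hE]
  congr 1
  rw [show (12 : ℂ) = (12 : ℕ) by norm_num, Nat.cast_smul_eq_nsmul, nsmul_eq_mul]
  norm_num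

end levelOneQExpansions

/-! ### The determinant of the iterated Serre derivatives -/

namespace QuasimodularDeterminant

/-- The derivation `12 q d/dq` of the ring of power series. -/
noncomputable def eulerTwelve : Derivation ℂ (PowerSeries ℂ) (PowerSeries ℂ) :=
  (12 : PowerSeries ℂ) • PowerSeries.euler

lemma eulerTwelve_apply (a : PowerSeries ℂ) : eulerTwelve a = 12 * PowerSeries.euler a := rfl

/-- The `q`-expansion of `12 q dE₂/dq - E₂²`, which equals `-E₄`. -/
noncomputable def ramanujanDefect : PowerSeries ℂ :=
  12 * PowerSeries.euler (qExpansion 1 E2) - qExpansion 1 E2 ^ 2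

/-- The iterated Serre derivatives of the quasimodular form `∑ⱼ E₂ʲ v j` of weight `w` and depth at
most `p`, as coefficients with respect to the powers of `E₂`. -/
noncomputable def iterate (w p : ℕ) (v : ℕ → PowerSeries ℂ) : ℕ → ℕ → PowerSeries ℂ :=
  serreIterate eulerTwelve (qExpansion 1 E2) ramanujanDefect w p v

/-- The square matrix of the coefficients of the first `p + 1` iterated Serre derivatives. -/
noncomputable def iterateMatrix (w p : ℕ) (v : ℕ → PowerSeries ℂ) :
    Matrix (Fin (p + 1)) (Fin (p + 1)) (PowerSeries ℂ) :=
  .of fun r j ↦ iterate w p v r j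

lemma iterate_mem {w p : ℕ} {v : ℕ → PowerSeries ℂ}
    (hv : ∀ j : ℕ, v j ∈ levelOneQExpansions (w - 2 * j)) (r j : ℕ) :
    iterate w p v r j ∈ levelOneQExpansions (w + 2 * r - 2 * j) := by
  have hcast {k l : ℤ} (h : k = l) {φ : PowerSeries ℂ} (hφ : φ ∈ levelOneQExpansions k) :
      φ ∈ levelOneQExpansions l := h ▸ hφ
  induction r generalizing j with
  | zero => exact hcast (by simp) (hv j)
  | succ r ih =>
    refine add_mem (add_mem ?_ ?_) ?_
    · exact hcast (by push_cast; ring) (levelOneQExpansions.serreDerivative_mem (ih j))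
    · rw [← zsmul_eq_mul]
      refine zsmul_mem ?_ _
      rcases j with _ | j
      · exact zero_mem _
      · exact hcast (by push_cast; ring) (ih j)
    · rw [mul_assoc, ← zsmul_eq_mul]
      exact zsmul_mem (hcast (by push_cast; ring)
        (SetLike.mul_mem_graded levelOneQExpansions.ramanujan_mem (ih (j + 1)))) _

lemma det_iterateMatrix_mem {w p : ℕ} {v : ℕ → PowerSeries ℂ}
    (hv : ∀ j : ℕ, v j ∈ levelOneQExpansions (w - 2 * j)) :
    (iterateMatrix w p v).det ∈ levelOneQExpansions (((p + 1) * w : ℕ) : ℤ) := by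
  rw [Matrix.det_apply]
  refine sum_mem fun σ _ ↦ ?_
  -- the weights add up to the same total for every permutation
  have hweight : ∑ j : Fin (p + 1), ((w : ℤ) + 2 * (σ j : ℕ) - 2 * (j : ℕ)) =
      (((p + 1) * w : ℕ) : ℤ) := by
    rw [Finset.sum_sub_distrib, Finset.sum_add_distrib,
      Equiv.sum_comp σ fun j : Fin (p + 1) ↦ (2 * (j : ℕ) : ℤ)]
    simp
  have h := SetLike.prod_mem_graded levelOneQExpansions
    (fun j : Fin (p + 1) ↦ (w : ℤ) + 2 * (σ j : ℕ) - 2 * (j : ℕ))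
    (fun j ↦ iterateMatrix w p v (σ j) j) (F := Finset.univ) fun j _ ↦ iterate_mem hv _ _
  rw [hweight] at h
  rcases Int.units_eq_one_or (Equiv.Perm.sign σ) with hσ | hσ
  · simpa [hσ] using h
  · simpa [hσ] using h

lemma binaryForm_one_eq (p : ℕ) (e : PowerSeries ℂ) (a : ℕ → PowerSeries ℂ) :
    binaryForm p 1 e a = ∑ j ∈ Finset.range (p + 1), e ^ j * a j := by
  simp [binaryForm]

/-- Cramer's rule: the determinant lies in the ideal generated by the iterated Serre derivatives of
`f`, all of which vanish at `i∞` to at least the order of `f`. -/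
lemma X_pow_dvd_det {w p : ℕ} {v : ℕ → PowerSeries ℂ} (hv : ∀ j, p < j → v j = 0) {n : ℕ}
    (hn : PowerSeries.X ^ n ∣ ∑ j ∈ Finset.range (p + 1), qExpansion 1 E2 ^ j * v j) :
    PowerSeries.X ^ n ∣ (iterateMatrix w p v).det := by
  set e := qExpansion 1 E2 with he
  have hdvd (r : ℕ) : PowerSeries.X ^ n ∣ binaryForm p 1 e (iterate w p v r) := by
    induction r with
    | zero => rwa [binaryForm_one_eq]
    | succ r ih =>
      have h := derivation_binaryForm eulerTwelve eulerTwelve (RingHom.id _) (fun _ ↦ rfl) e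
        ramanujanDefect w p hv (x := 1) (y := e) (by simp)
        (by simp [eulerTwelve_apply, ramanujanDefect, ← he]; ring) r
      have h' := eq_sub_of_add_eq h.symm
      simp only [RingHom.id_apply] at h'
      exact (congrArg (PowerSeries.X ^ n ∣ ·) h').mpr (dvd_sub
        (Dvd.dvd.mul_left (PowerSeries.X_pow_dvd_euler ih) _) (Dvd.dvd.mul_left ih _))
  have hmul : (iterateMatrix w p v).mulVec (fun j ↦ e ^ (j : ℕ)) =
      fun r : Fin (p + 1) ↦ binaryForm p 1 e (iterate w p v r) := by
    ext1 r
    rw [binaryForm_one_eq, ← Fin.sum_univ_eq_sum_range (fun j ↦ e ^ j * iterate w p v r j)]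
    change ∑ j : Fin (p + 1), iterateMatrix w p v r j * e ^ (j : ℕ) = _
    exact Finset.sum_congr rfl fun j _ ↦ mul_comm (iterateMatrix w p v r j) (e ^ (j : ℕ))
  have h := congrFun (congrArg (iterateMatrix w p v).adjugate.mulVec hmul) 0
  rw [Matrix.mulVec_mulVec, Matrix.adjugate_mul, Matrix.smul_mulVec, Matrix.one_mulVec] at h
  have h0 : (iterateMatrix w p v).det =
      ∑ r, (iterateMatrix w p v).adjugate 0 r * binaryForm p 1 e (iterate w p v r) := by
    simpa using! h
  rw [h0]
  exact Finset.dvd_sum fun r _ ↦ Dvd.dvd.mul_left (hdvd r) _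

open Polynomial in
/-- The binary form in `X` and `X ε + c` has degree at most `p` in `X`, and its coefficient at `Xᵖ` is
`∑ⱼ εʲ a j`. -/
lemma natDegree_binaryForm_le_and_coeff {F : Type*} [Field F] (p : ℕ) (ε c : F) (a : ℕ → F) :
    (binaryForm p X (X * C ε + C c) fun j ↦ C (a j)).natDegree ≤ p ∧
      (binaryForm p X (X * C ε + C c) fun j ↦ C (a j)).coeff p =
        ∑ j ∈ Finset.range (p + 1), ε ^ j * a j := by
  have hy : (X * C ε + C c).natDegree ≤ 1 := by compute_degree
  have hypow (j : ℕ) : ((X * C ε + C c) ^ j).natDegree ≤ j := by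
    simpa using natDegree_pow_le_of_le j hy
  have hle (j : ℕ) (hj : j ∈ Finset.range (p + 1)) : p - j + j = p :=
    Nat.sub_add_cancel (Nat.lt_succ_iff.mp (Finset.mem_range.mp hj))
  constructor
  · refine natDegree_sum_le_of_forall_le _ _ fun j hj ↦ ?_
    refine (natDegree_mul_C_le _ _).trans ?_
    refine (natDegree_mul_le_of_le (natDegree_X_pow_le (p - j)) (hypow j)).trans (hle j hj).le
  · rw [binaryForm, finsetSum_coeff]
    refine Finset.sum_congr rfl fun j hj ↦ ?_
    rw [coeff_mul_C]
    congr 1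
    nth_rewrite 2 [← hle j hj]
    rw [coeff_mul_add_eq_of_natDegree_le (natDegree_X_pow_le (p - j)) (hypow j),
      coeff_X_pow_self, one_mul]
    have := coeff_pow_of_natDegree_le (m := j) hy
    rw [mul_one] at this
    rw [this]
    simp [coeff_C]

open Polynomial in
/-- The determinant vanishes only for `f = 0`. Over a differential field `F` in which no nonzero
integer is a derivative, the rows of the matrix are coefficients of iterated derivatives of a
polynomial in `X`, and the coefficient of that polynomial at `Xᵖ` is `f`. -/
lemma det_iterateMatrix_ne_zero_of_injective {F : Type*} [Field F] {ι : PowerSeries ℂ →+* F}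
    (hι : Injective ι) {d : Derivation ℤ F F} (hιd : ∀ a, ι (eulerTwelve a) = d (ι a))
    (hc : ∀ (u : F) (n : ℕ), n ≠ 0 → d u + n * 12 ≠ 0) {w p : ℕ} {v : ℕ → PowerSeries ℂ}
    (hv : ∀ j, p < j → v j = 0)
    (hf : ∑ j ∈ Finset.range (p + 1), qExpansion 1 E2 ^ j * v j ≠ 0) :
    (iterateMatrix w p v).det ≠ 0 := by
  set e := qExpansion 1 E2 with he
  let y : F[X] := X * C (ι e) + C 12
  let Φ : ℕ → F[X] := fun r ↦ binaryForm p X y fun j ↦ C (ι (iterate w p v r j))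
  have hΦ (r : ℕ) : d.extendPolynomial 12 (Φ r) =
      Φ (r + 1) + (((w : ℤ) + 2 * r - p : ℤ) * ι e) • Φ r := by
    have h := derivation_binaryForm eulerTwelve (d.extendPolynomial 12) (C.comp ι)
      (fun a ↦ by simp [hιd, Derivation.extendPolynomial_C]) e ramanujanDefect w p hv
      (x := X) (y := y) (by simp [y, Derivation.extendPolynomial_X]) ?_ r
    · rw [smul_eq_C_mul, map_mul, map_intCast]
      exact h
    · have hδ : eulerTwelve e = e ^ 2 + ramanujanDefect := by
        rw [eulerTwelve_apply, ramanujanDefect, ← he]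
        ring
      have h12 : d 12 = 0 := d.map_natCast 12
      simp only [y, map_add, Derivation.leibniz, Derivation.extendPolynomial_C,
        Derivation.extendPolynomial_X, ← hιd, hδ, h12, smul_eq_mul, RingHom.comp_apply, map_pow]
      simp only [map_zero]
      ring
  have hcoeff : (Φ 0).natDegree ≤ p ∧
      (Φ 0).coeff p = ι (∑ j ∈ Finset.range (p + 1), e ^ j * v j) := by
    have h := natDegree_binaryForm_le_and_coeff p (ι e) 12 fun j ↦ ι (v j)
    refine ⟨h.1, h.2.trans ?_⟩
    simp
  have hne : (Φ 0).coeff p ≠ 0 := by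
    rw [hcoeff.2]
    exact (map_ne_zero_iff ι hι).mpr hf
  have hdeg : (Φ 0).natDegree = p := natDegree_eq_of_le_of_coeff_ne_zero hcoeff.1 hne
  have hlin := linearIndependent_of_extendPolynomial hc hΦ (m := p + 1)
    (fun h ↦ hne (by rw [h, coeff_zero])) (by rw [hdeg])
  intro hdet
  obtain ⟨a, ha0, ha⟩ := Matrix.exists_vecMul_eq_zero_iff.mpr hdet
  refine ha0 (funext fun r ↦ hι ?_)
  rw [Pi.zero_apply, map_zero]
  refine Fintype.linearIndependent_iff.mp hlin (fun r ↦ ι (a r)) ?_ r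
  simp only [Φ, binaryForm, smul_eq_C_mul, Finset.mul_sum]
  rw [Finset.sum_comm]
  refine Finset.sum_eq_zero fun j hj ↦ ?_
  have hcol := congrFun ha ⟨j, Finset.mem_range.mp hj⟩
  have hcol' : ∑ r, a r * iterate w p v r j = 0 := hcol
  calc ∑ r, C (ι (a r)) * (X ^ (p - j) * y ^ j * C (ι (iterate w p v r j)))
      = X ^ (p - j) * y ^ j * C (ι (∑ r, a r * iterate w p v r j)) := by
        simp only [map_sum, map_mul, Finset.mul_sum]
        exact Finset.sum_congr rfl fun r _ ↦ by ring
    _ = 0 := by rw [hcol', map_zero, map_zero, mul_zero]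

lemma det_iterateMatrix_ne_zero {w p : ℕ} {v : ℕ → PowerSeries ℂ} (hv : ∀ j, p < j → v j = 0)
    (hf : ∑ j ∈ Finset.range (p + 1), qExpansion 1 E2 ^ j * v j ≠ 0) :
    (iterateMatrix w p v).det ≠ 0 := by
  let ι : PowerSeries ℂ →+* LaurentSeries ℂ := HahnSeries.ofPowerSeries ℤ ℂ
  have hι : Injective ι := HahnSeries.ofPowerSeries_injective
  have hd (u : LaurentSeries ℂ) :
      ((12 : LaurentSeries ℂ) • LaurentSeries.euler) u = 12 * LaurentSeries.euler u := rfl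
  refine det_iterateMatrix_ne_zero_of_injective hι
    (d := (12 : LaurentSeries ℂ) • LaurentSeries.euler) (fun a ↦ ?_) (fun u n hn h ↦ hn ?_) hv hf
  · rw [hd, eulerTwelve_apply, map_mul, map_ofNat, PowerSeries.ofPowerSeries_euler]
  · have h12 : (12 : LaurentSeries ℂ) ≠ 0 := by
      rw [← map_ofNat HahnSeries.C 12]
      exact HahnSeries.C_ne_zero (by norm_num)
    have h' : LaurentSeries.euler u = -(n : LaurentSeries ℂ) := by
      rw [hd] at h
      apply mul_left_cancel₀ h12
      linear_combination h
    -- a derivative has no constant term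
    have h0 := congrArg (fun x : LaurentSeries ℂ ↦ x.coeff 0) h'
    rw [← HahnSeries.single_zero_natCast] at h0
    simpa using h0

end QuasimodularDeterminant

/-! ### The order of vanishing of a quasimodular form -/

namespace IsQuasimodularForm

lemma sub {w : ℕ} {f g : ℍ → ℂ} (hf : IsQuasimodularForm w f) (hg : IsQuasimodularForm w g) :
    IsQuasimodularForm w (f - g) := by
  obtain ⟨F, hF⟩ := hf
  obtain ⟨G, hG⟩ := hg
  refine ⟨fun j ↦ F j - G j, fun z ↦ ?_⟩
  simp [hF, hG, mul_sub]

lemma mem_and_qExpansion_eq {w : ℕ} {f : ℍ → ℂ}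
    {g : (j : ℕ) → ModularForm 𝒮ℒ ((w : ℤ) - 2 * (j : ℤ))}
    (hf : ∀ z, f z = ∑ j ∈ Finset.range (w / 2 + 1), E2 z ^ j * g j z) :
    f ∈ cuspRegularFunctions ∧ qExpansion 1 f =
      ∑ j ∈ Finset.range (w / 2 + 1), qExpansion 1 E2 ^ j * qExpansion 1 (g j) := by
  let E : cuspRegularFunctions := ⟨E2, cuspRegularFunctions.E2_mem⟩
  let G (j : ℕ) : cuspRegularFunctions := ⟨g j, cuspRegularFunctions.coe_mem (g j)⟩
  have hF : f = (∑ j ∈ Finset.range (w / 2 + 1), E ^ j * G j : cuspRegularFunctions) := by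
    ext z
    simp [hf, E, G]
  rw [hF]
  refine ⟨Subtype.property _, ?_⟩
  rw [← cuspRegularFunctions.qExpansionHom_apply]
  simp only [map_sum, map_mul, map_pow]
  rfl

lemma mem {w : ℕ} {f : ℍ → ℂ} (hf : IsQuasimodularForm w f) : f ∈ cuspRegularFunctions :=
  let ⟨_, hg⟩ := hf
  (mem_and_qExpansion_eq hg).1

/-- A quasimodular form of weight `w` that vanishes at `i∞` to an order greater than
`(w / 2 + 1) w / 12` is zero. -/
theorem eq_zero_of_X_pow_dvd {w : ℕ} {f : ℍ → ℂ} (hf : IsQuasimodularForm w f) {n : ℕ}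
    (hn : (w / 2 + 1) * w / 12 < n) (h : PowerSeries.X ^ n ∣ qExpansion 1 f) : f = 0 := by
  obtain ⟨g, hg⟩ := hf
  obtain ⟨hmem, hq⟩ := mem_and_qExpansion_eq hg
  rw [← cuspRegularFunctions.qExpansion_eq_zero_iff hmem]
  set v : ℕ → PowerSeries ℂ := fun j ↦ if w / 2 < j then 0 else qExpansion 1 (g j) with hv
  have hv0 (j : ℕ) (hj : w / 2 < j) : v j = 0 := if_pos hj
  have hvmem (j : ℕ) : v j ∈ levelOneQExpansions (w - 2 * j) := by
    rw [hv]
    dsimp only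
    split_ifs
    · exact zero_mem _
    · exact ⟨g j, rfl⟩
  have hsum : qExpansion 1 f = ∑ j ∈ Finset.range (w / 2 + 1), qExpansion 1 E2 ^ j * v j := by
    rw [hq]
    refine Finset.sum_congr rfl fun j hj ↦ ?_
    rw [hv]
    dsimp only
    rw [if_neg (by have := Finset.mem_range.mp hj; omega)]
  rw [hsum] at h ⊢
  by_contra hne
  refine QuasimodularDeterminant.det_iterateMatrix_ne_zero (w := w) hv0 hne ?_
  exact levelOneQExpansions.eq_zero_of_X_pow_dvd
    (QuasimodularDeterminant.det_iterateMatrix_mem hvmem) (by rwa [Int.toNat_natCast])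
    (QuasimodularDeterminant.X_pow_dvd_det hv0 h)

end IsQuasimodularForm

lemma weight_bound_le {k w : ℕ} (hk : 1 ≤ k) (hw : w = k ∨ w = 2 * k) :
    (w / 2 + 1) * w / 12 ≤ ⌈(k : ℝ) ^ 4 * Real.log k / 2⌉₊ := by
  have hw' : (w / 2 + 1) * w / 12 ≤ (k + 1) * (2 * k) / 12 := by
    gcongr <;> omega
  refine hw'.trans ?_
  rcases hk.eq_or_lt with rfl | hk
  · norm_num
  have hlog : 1 / 2 ≤ Real.log k :=
    (by linarith [Real.log_two_gt_d9] : (1 : ℝ) / 2 ≤ Real.log 2).trans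
      (Real.log_le_log two_pos (by exact_mod_cast hk))
  have hk2 : (2 : ℝ) ≤ k := by exact_mod_cast hk
  refine (Nat.cast_le (α := ℝ)).mp (le_trans ?_ (Nat.le_ceil _))
  calc (((k + 1) * (2 * k) / 12 : ℕ) : ℝ)
      ≤ (((k + 1) * (2 * k) : ℕ) : ℝ) / (12 : ℕ) := Nat.cast_div_le
    _ ≤ (k : ℝ) ^ 4 * (1 / 2) / 2 := by
      push_cast
      nlinarith [mul_nonneg (sub_nonneg.mpr hk2) (sub_nonneg.mpr hk2), sq_nonneg ((k : ℝ) ^ 2 - k),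
        sq_nonneg (k : ℝ)]
    _ ≤ (k : ℝ) ^ 4 * Real.log k / 2 := by gcongr

theorem theorem1p4 (k : ℕ) (hk : 1 ≤ k) (w : ℕ) (hw : w = k ∨ w = 2 * k) :
    (∀ f g : UpperHalfPlane → ℂ, IsQuasimodularForm w f → IsQuasimodularForm w g →
      (∀ n < ⌈(k : ℝ) ^ 4 * Real.log k / 2⌉₊ + 1,
        fourierCoefficient f n = fourierCoefficient g n) → f = g) ∧
    (∀ f : UpperHalfPlane → ℂ, IsQuasimodularForm w f →
      (⌈(k : ℝ) ^ 4 * Real.log k / 2⌉₊ : ℕ∞) < ordAtInfinity f → f = 0) := by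
  have hbound := Nat.lt_succ_of_le (weight_bound_le hk hw)
  refine ⟨fun f g hf hg h ↦ ?_, fun f hf h ↦ ?_⟩
  · refine sub_eq_zero.mp ((hf.sub hg).eq_zero_of_X_pow_dvd hbound ?_)
    rw [qExpansion_sub (cuspRegularFunctions.analyticAt hf.mem)
      (cuspRegularFunctions.analyticAt hg.mem), PowerSeries.X_pow_dvd_iff]
    intro n hn
    rw [map_sub, sub_eq_zero]
    exact h n hn
  · refine hf.eq_zero_of_X_pow_dvd hbound (PowerSeries.X_pow_dvd_iff.mpr fun n hn ↦ ?_)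
    exact PowerSeries.coeff_of_lt_order _
      ((Nat.cast_le.mpr (Nat.lt_succ_iff.mp hn)).trans_lt h)
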